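/- **Conventions.** A *weight function* is a non-decreasing function $\omega:[0,+\infty)\to[0,+\infty)$ with $\lim_{t\to+\infty}\omega(t)=+\infty$. It is *normalized* if $\omega(t)=0$ for $0\le t\le 1$, and *quasianalytic* if $\int_1^{\infty}\frac{\omega(t)}{t^2}\,dt=+\infty$. A *BMT-weight function* is a continuous non-decreasing function $\omega:[0,+\infty)\to[0,+\infty)$ with $\omega(0)=0$, such that $\omega(2t)=O(\omega(t))$ and $\log t=o(\omega(t))$ as $t\to+\infty$, and such that $t\mapsto\omega(e^t)$ is convex on $\mathbb{R}$. Two functions $\sigma,\tau:[0,+\infty)\to[0,+\infty)$ are *equivalent* if $\sigma(t)=O(\tau(t))$ and $\tau(t)=O(\sigma(t))$ as $t\to+\infty$. A weight function $\omega$ is *almost subadditive* if $$\forall\,q>1\;\exists\,C_q\ge 1\;\forall\,s,t\ge 0:\quad\omega(s+t)\le q(\omega(s)+\omega(t))+C_q.$$ Let $\mathcal{LC}$ be the set of all sequences $M=(M_j)_{j\ge 0}$ of positive reals with $1=M_0\le M_1$, $M_j^2\le M_{j-1}M_{j+1}$ for all $j\ge 1$, and $\lim_{j\to+\infty}(M_j)^{1/j}=+\infty$.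 For $M\in\mathcal{LC}$ put $\mu_0:=1$, $\mu_j:=M_j/M_{j-1}$ for $j\ge 1$, and let $\omega_M(t):=\sup_{j\ge 0}\log\left(\frac{t^j}{M_j}\right)$ for $t>0$, $\omega_M(0):=0$. **Theorem 3.8.** There exist sequences $M\in\mathcal{LC}$ such that $\omega_M$ is a normalized quasianalytic BMT-weight function which is not equivalent to any almost subadditive weight function. In addition, each of the following three situations occurs for some such $M$: * Case (a): $\lim_{k\to+\infty}\frac{\mu_k}{k}=0$. * Case (b): $\lim_{k\to+\infty}\frac{\mu_k}{k}=+\infty$. * Case (c): $\liminf_{k\to+\infty}\frac{\mu_k}{k}=0$ and $\limsup_{k\to+\infty}\frac{\mu_k}{k}=+\infty$. -/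

import Mathlib

open Filter Topology Asymptotics

namespace UltraWeight

/-! Functions `[0,+∞) → [0,+∞)` are represented by functions `ℝ → ℝ` all of whose properties
concern only their values on `[0,+∞)`; non-negativity there is part of the definitions. -/

/-- Weight functions: non-decreasing maps `[0,+∞) → [0,+∞)` tending to `+∞`. -/
structure IsWeightFunction (ω : ℝ → ℝ) : Prop where
  nonneg : ∀ t, 0 ≤ t → 0 ≤ ω t
  mono : MonotoneOn ω (Set.Ici 0)
  tendsto : Tendsto ω atTop atTop

/-- Braun-Meise-Taylor weight functions. -/
structure IsBMTWeight (ω : ℝ → ℝ) : Prop where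
  nonneg : ∀ t, 0 ≤ t → 0 ≤ ω t
  continuousOn : ContinuousOn ω (Set.Ici 0)
  mono : MonotoneOn ω (Set.Ici 0)
  zero : ω 0 = 0
  /-- condition `ω(2t) = O(ω(t))` -/
  om1 : (fun t => ω (2 * t)) =O[atTop] ω
  /-- condition `log t = o(ω(t))` -/
  om3 : Real.log =o[atTop] ω
  /-- convexity of `t ↦ ω(eᵗ)` on `ℝ` -/
  om4 : ConvexOn ℝ Set.univ (fun t => ω (Real.exp t))

/-- Normalization: `ω` vanishes on `[0,1]`. -/
def IsNormalizedWeight (ω : ℝ → ℝ) : Prop :=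
  ∀ t, 0 ≤ t → t ≤ 1 → ω t = 0

/-- Non-quasianalyticity: `∫₁^∞ ω(t)/t² dt < +∞`. -/
def IsNonQuasianalytic (ω : ℝ → ℝ) : Prop :=
  MeasureTheory.IntegrableOn (fun t => ω t / t ^ 2) (Set.Ioi 1)

/-- Quasianalyticity: the integral `∫₁^∞ ω(t)/t² dt` diverges. -/
def IsQuasianalytic (ω : ℝ → ℝ) : Prop :=
  ¬ IsNonQuasianalytic ω

/-- Equivalence of weights: `σ = O(τ)` and `τ = O(σ)` at `+∞`. -/
def WeightEquiv (σ τ : ℝ → ℝ) : Prop :=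
  τ =O[atTop] σ ∧ σ =O[atTop] τ

/-- Almost subadditivity. -/
def IsAlmostSubadditive (ω : ℝ → ℝ) : Prop :=
  ∀ q : ℝ, 1 < q → ∃ C : ℝ, 1 ≤ C ∧
    ∀ s t : ℝ, 0 ≤ s → 0 ≤ t → ω (s + t) ≤ q * (ω s + ω t) + C

/-- The class `LC` of weight sequences: positive, normalized, log-convex sequences with
`(M_j)^{1/j} → +∞`. -/
structure IsLC (M : ℕ → ℝ) : Prop where
  pos : ∀ j, 0 < M j
  zero : M 0 = 1
  one_le : 1 ≤ M 1
  logConvex : ∀ j, M (j + 1) ^ 2 ≤ M j * M (j + 2)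
  tendsto_root : Tendsto (fun j : ℕ => M j ^ (1 / (j : ℝ))) atTop atTop

/-- The quotients `μ_0 = 1`, `μ_j = M_j / M_{j-1}` for `j ≥ 1`. -/
noncomputable def quotient (M : ℕ → ℝ) : ℕ → ℝ
  | 0 => 1
  | j + 1 => M (j + 1) / M j

/-- The associated function `ω_M(t) = sup_j log(|t|^j / M_j)` for `t ≠ 0`, and `ω_M(0) = 0`.
The supremum is taken in `ℝ`; by `IsLC.bddAbove_log` it is a genuine supremum for `M ∈ LC`. -/
noncomputable def assocWeight (M : ℕ → ℝ) (t : ℝ) : ℝ :=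
  if t = 0 then 0 else ⨆ j : ℕ, Real.log (|t| ^ j / M j)

theorem IsLC.bddAbove_log {M : ℕ → ℝ} (hM : IsLC M) (t : ℝ) :
    BddAbove (Set.range fun j : ℕ => Real.log (|t| ^ j / M j)) := by
  apply Filter.IsBoundedUnder.bddAbove_range
  refine ⟨0, ?_⟩
  rw [Filter.eventually_map]
  filter_upwards [hM.tendsto_root.eventually_ge_atTop |t|, eventually_ge_atTop 1] with j hj h1
  have hj0 : (j : ℝ) ≠ 0 := by positivity
  have hpos := hM.pos j
  have h : |t| ^ j ≤ M j := by
    calc |t| ^ j ≤ (M j ^ (1 / (j : ℝ))) ^ j := by gcongr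
      _ = M j := by
        rw [← Real.rpow_natCast, ← Real.rpow_mul hpos.le, one_div_mul_cancel hj0, Real.rpow_one]
  exact Real.log_nonpos (by positivity) ((div_le_one hpos).2 h)

/-- `M` is a weight sequence whose associated function is a normalized quasianalytic BMT-weight
function which is not equivalent to any almost subadditive weight function. -/
structure IsQuasianalyticExample (M : ℕ → ℝ) : Prop where
  lc : IsLC M
  bmt : IsBMTWeight (assocWeight M)
  normalized : IsNormalizedWeight (assocWeight M)
  quasianalytic : IsQuasianalytic (assocWeight M)
  not_equiv : ¬ ∃ τ : ℝ → ℝ,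
    IsWeightFunction τ ∧ WeightEquiv (assocWeight M) τ ∧ IsAlmostSubadditive τ

end UltraWeight

namespace UltraWeight

/-! Prescribe the quotients instead of `M`. Put `a_n = 2 ^ 4 ^ n` and, for `i` in the block `[a_n,
a_n ^ 4)`, `μ_i = √(i + 1) * c_n` with `c` non-decreasing and `c_n ≥ 1`. Since `ω(t)` is a supremum
of sums of `log (t / μ_i)`, it can be read off from the quotients below `t`: at `t = a_n c_n` only
indices below `a_n ^ 2` contribute, so `ω(t) ≤ a_n ^ 2 log t`, while `ω(4 a_n ^ 2 c_n) ≥ a_n ^ 4`.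
Thus multiplying `t` by `4 a_n` multiplies `ω` by about `a_n ^ 2`, up to a logarithm. An almost
subadditive `τ` (with `q = 3/2`) grows at most by a factor `3` per doubling, up to constants, and
this survives equivalence; quadratic growth means `4` per doubling (`not_equiv_block`). The
condition `c_n ≤ (n + 1) a_n ^ 2` makes the integral over `[S, 2S]`, `S = 4 a_n ^ 2 c_n`, at least
`1 / (16 (n + 1))`, whence quasianalyticity (`isQuasianalytic_block`). The three cases only differ
in `c`: `1`, `(n + 1) a_n ^ 2` and `a_n`. -/

/-! ### Weight sequences built from their quotients. -/

/-- The weight sequence with quotients `μ 0, μ 1, …`. -/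
noncomputable def weightSeq (μ : ℕ → ℝ) (j : ℕ) : ℝ := ∏ i ∈ Finset.range j, μ i

theorem quotient_weightSeq {μ : ℕ → ℝ} (hμ : ∀ i, 1 ≤ μ i) (j : ℕ) :
    quotient (weightSeq μ) (j + 1) = μ j := by
  have h : weightSeq μ j ≠ 0 :=
    (Finset.prod_pos fun i _ => zero_lt_one.trans_le (hμ i)).ne'
  rw [quotient, weightSeq, Finset.prod_range_succ, ← weightSeq, mul_div_cancel_left₀ _ h]

theorem one_le_weightSeq {μ : ℕ → ℝ} (hμ : ∀ i, 1 ≤ μ i) (j : ℕ) : 1 ≤ weightSeq μ j :=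
  Finset.prod_induction _ (fun x : ℝ => 1 ≤ x) (fun _ _ => one_le_mul_of_one_le_of_one_le)
    le_rfl fun i _ => hμ i

theorem log_pow_div_weightSeq {μ : ℕ → ℝ} (hμ : ∀ i, 1 ≤ μ i) {t : ℝ} (ht : 0 < t) (j : ℕ) :
    Real.log (|t| ^ j / weightSeq μ j) = ∑ i ∈ Finset.range j, Real.log (t / μ i) := by
  rw [← Real.log_prod fun i _ => (div_pos ht (zero_lt_one.trans_le (hμ i))).ne',
    Finset.prod_div_distrib, Finset.prod_const, Finset.card_range, abs_of_pos ht, weightSeq]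

/-- The product dominates `√(j!)`, and `j! ≥ (j / e) ^ j`. -/
theorem sqrt_le_weightSeq_rpow {μ : ℕ → ℝ} (hμ : ∀ i : ℕ, √((i : ℝ) + 1) ≤ μ i) {j : ℕ}
    (hj : 1 ≤ j) : √(j / Real.exp 1) ≤ weightSeq μ j ^ (1 / (j : ℝ)) := by
  have hj0 : (0 : ℝ) < j := by exact_mod_cast hj
  have h1 : √(j.factorial : ℝ) ≤ weightSeq μ j := by
    have : √(j.factorial : ℝ) = ∏ i ∈ Finset.range j, √((i : ℝ) + 1) := by
      induction j with
      | zero => simp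
      | succ k ih =>
        rcases Nat.eq_zero_or_pos k with rfl | hk
        · simp
        · rw [Finset.prod_range_succ, ← ih hk (by exact_mod_cast hk), Nat.factorial_succ,
            Nat.cast_mul, Real.sqrt_mul (by positivity), mul_comm, Nat.cast_succ]
    rw [this]
    exact Finset.prod_le_prod (fun i _ => Real.sqrt_nonneg _) fun i _ => hμ i
  have h2 : ((j : ℝ) / Real.exp 1) ^ j ≤ j.factorial := by
    have := Real.pow_div_factorial_le_exp (j : ℝ) hj0.le j
    rw [div_le_iff₀ (by positivity)] at this
    rw [div_pow, div_le_iff₀ (by positivity), ← Real.exp_nat_mul, mul_one]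
    linarith
  have h3 : √((j : ℝ) / Real.exp 1) ^ j ≤ weightSeq μ j := by
    refine le_trans ?_ h1
    apply Real.le_sqrt_of_sq_le
    rwa [← pow_mul, mul_comm, pow_mul, Real.sq_sqrt (by positivity)]
  calc √((j : ℝ) / Real.exp 1) = (√((j : ℝ) / Real.exp 1) ^ j) ^ (1 / (j : ℝ)) := by
        rw [one_div, Real.pow_rpow_inv_natCast (Real.sqrt_nonneg _) (by omega)]
    _ ≤ _ := Real.rpow_le_rpow (by positivity) h3 (by positivity)

theorem isLC_weightSeq {μ : ℕ → ℝ} (hmono : Monotone μ)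
    (hμ : ∀ i : ℕ, √((i : ℝ) + 1) ≤ μ i) : IsLC (weightSeq μ) := by
  have h1 : ∀ i, 1 ≤ μ i := fun i =>
    le_trans (Real.one_le_sqrt.2 (by linarith [i.cast_nonneg (α := ℝ)])) (hμ i)
  have hpos : ∀ j, 0 < weightSeq μ j := fun j => zero_lt_one.trans_le (one_le_weightSeq h1 j)
  refine ⟨hpos, by simp [weightSeq], one_le_weightSeq h1 1, fun j => ?_, ?_⟩
  · have e1 : weightSeq μ (j + 1) = weightSeq μ j * μ j := Finset.prod_range_succ _ _
    have e2 : weightSeq μ (j + 2) = weightSeq μ (j + 1) * μ (j + 1) := Finset.prod_range_succ _ _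
    rw [e2, e1]
    have h3 := mul_le_mul_of_nonneg_left (hmono (Nat.le_succ j))
      (mul_nonneg (sq_nonneg (weightSeq μ j)) (zero_le_one.trans (h1 j)))
    linarith
  · refine tendsto_atTop_mono' atTop
      (f₁ := fun j : ℕ => √((j : ℝ) / Real.exp 1)) ?_ ?_
    · filter_upwards [eventually_ge_atTop 1] with j hj using sqrt_le_weightSeq_rpow hμ hj
    · exact Real.tendsto_sqrt_atTop.comp
        (tendsto_natCast_atTop_atTop.atTop_div_const (Real.exp_pos 1))

/-! ### General properties of the associated function. -/

section AssocWeight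

variable {M : ℕ → ℝ}

theorem IsLC.log_le_assocWeight (hM : IsLC M) {t : ℝ} (ht : 0 < t) (j : ℕ) :
    Real.log (|t| ^ j / M j) ≤ assocWeight M t := by
  rw [assocWeight, if_neg ht.ne']
  exact le_ciSup (hM.bddAbove_log t) j

theorem assocWeight_le {t B : ℝ} (ht : 0 < t) (h : ∀ j, Real.log (|t| ^ j / M j) ≤ B) :
    assocWeight M t ≤ B := by
  rw [assocWeight, if_neg ht.ne']
  exact ciSup_le h

theorem IsLC.assocWeight_nonneg (hM : IsLC M) {t : ℝ} (ht : 0 ≤ t) : 0 ≤ assocWeight M t := by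
  rcases ht.eq_or_lt with rfl | ht
  · simp [assocWeight]
  · simpa [hM.zero] using hM.log_le_assocWeight ht 0

theorem IsLC.monotoneOn_assocWeight (hM : IsLC M) : MonotoneOn (assocWeight M) (Set.Ici 0) := by
  intro s hs t ht hst
  rcases (Set.mem_Ici.1 hs).eq_or_lt with rfl | hs
  · rw [assocWeight, if_pos rfl]
    exact hM.assocWeight_nonneg ht
  · have ht' := hs.trans_le hst
    refine assocWeight_le hs fun j => le_trans ?_ (hM.log_le_assocWeight ht' j)
    have := hM.pos j
    have := abs_pos.2 hs.ne'
    refine Real.log_le_log (by positivity) ?_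
    rw [abs_of_pos hs, abs_of_pos ht']
    gcongr

theorem IsLC.log_pow_div (hM : IsLC M) {t : ℝ} (ht : 0 < t) (j : ℕ) :
    Real.log (|t| ^ j / M j) = j * Real.log t - Real.log (M j) := by
  rw [abs_of_pos ht, Real.log_div (by positivity) (hM.pos j).ne', Real.log_pow]

theorem IsLC.convexOn_assocWeight (hM : IsLC M) :
    ConvexOn ℝ Set.univ (fun x => assocWeight M (Real.exp x)) := by
  refine ⟨convex_univ, fun x _ y _ a b ha hb hab => ?_⟩
  refine assocWeight_le (Real.exp_pos _) fun j => ?_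
  have hx := hM.log_le_assocWeight (Real.exp_pos x) j
  have hy := hM.log_le_assocWeight (Real.exp_pos y) j
  rw [hM.log_pow_div (Real.exp_pos _), Real.log_exp] at hx hy ⊢
  simp only [smul_eq_mul]
  have h1 := mul_le_mul_of_nonneg_left hx ha
  have h2 := mul_le_mul_of_nonneg_left hy hb
  have h3 : Real.log (M j) = (a + b) * Real.log (M j) := by rw [hab, one_mul]
  rw [h3]
  linarith

theorem IsLC.isNormalizedWeight (hM : IsLC M) (h1 : ∀ j, 1 ≤ M j) :
    IsNormalizedWeight (assocWeight M) := by
  intro t ht0 ht1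
  rcases ht0.eq_or_lt with rfl | ht
  · simp [assocWeight]
  refine le_antisymm (assocWeight_le ht fun j => ?_) (hM.assocWeight_nonneg ht0)
  have := hM.pos j
  rw [abs_of_pos ht]
  exact Real.log_nonpos (by positivity)
    (div_le_one_of_le₀ ((pow_le_one₀ ht0 ht1).trans (h1 j)) (hM.pos j).le)

theorem IsLC.continuousOn_assocWeight (hM : IsLC M) (h1 : ∀ j, 1 ≤ M j) :
    ContinuousOn (assocWeight M) (Set.Ici 0) := by
  intro t ht
  rcases (Set.mem_Ici.1 ht).eq_or_lt with rfl | ht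
  · refine (continuousWithinAt_const (b := (0 : ℝ))).congr_of_eventuallyEq ?_
      (by simp [assocWeight])
    filter_upwards [self_mem_nhdsWithin, mem_nhdsWithin_of_mem_nhds (Iio_mem_nhds one_pos)]
      with s hs hs1
    exact hM.isNormalizedWeight h1 s hs (le_of_lt hs1)
  · have hc : Continuous fun x => assocWeight M (Real.exp x) :=
      continuousOn_univ.1 (hM.convexOn_assocWeight.continuousOn isOpen_univ)
    have h2 : ContinuousAt (fun s => assocWeight M (Real.exp (Real.log s))) t :=
      ContinuousAt.comp (f := Real.log) (g := fun x => assocWeight M (Real.exp x))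
        hc.continuousAt (Real.continuousAt_log ht.ne')
    refine (h2.congr ?_).continuousWithinAt
    filter_upwards [lt_mem_nhds ht] with s hs
    rw [Real.exp_log hs]

theorem IsLC.log_isLittleO (hM : IsLC M) : Real.log =o[atTop] assocWeight M := by
  rw [isLittleO_iff]
  intro c hc
  -- With `c * j ≥ 2`, one copy of `log t` absorbs `c * log (M j)` and the other remains.
  obtain ⟨j, hj⟩ := exists_nat_ge (2 / c)
  rw [div_le_iff₀ hc] at hj
  filter_upwards [Real.tendsto_log_atTop.eventually_ge_atTop (c * Real.log (M j)),
    eventually_ge_atTop 1] with t h1 ht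
  have hl : 0 ≤ Real.log t := Real.log_nonneg ht
  have ht0 : 0 < t := by linarith
  have h2 := hM.log_le_assocWeight ht0 j
  rw [hM.log_pow_div ht0] at h2
  rw [Real.norm_of_nonneg hl, Real.norm_of_nonneg (hM.assocWeight_nonneg ht0.le)]
  have h3 := mul_le_mul_of_nonneg_left h2 hc.le
  have h4 := mul_le_mul_of_nonneg_right hj hl
  linarith

theorem IsLC.tendsto_assocWeight (hM : IsLC M) : Tendsto (assocWeight M) atTop atTop := by
  have h : ∀ᶠ t in atTop, Real.log t ≤ assocWeight M t := by
    filter_upwards [isLittleO_iff.1 hM.log_isLittleO one_pos, eventually_ge_atTop 1] with t h1 ht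
    rwa [Real.norm_of_nonneg (Real.log_nonneg ht),
      Real.norm_of_nonneg (hM.assocWeight_nonneg (by linarith)), one_mul] at h1
  exact tendsto_atTop_mono' _ h Real.tendsto_log_atTop

end AssocWeight

/-! ### The doubling condition. -/

/-- The weights `8 - r` and `r` are non-negative with sum `8`, so a bound on all partial sums of `f`
passes to the left side with factor `8`. -/
theorem sum_range_div_eight (f : ℕ → ℝ) (n r : ℕ) (hr : r < 8) :
    ∑ i ∈ Finset.range (8 * n + r), f (i / 8) =
      (8 - r) * ∑ l ∈ Finset.range n, f l + r * ∑ l ∈ Finset.range (n + 1), f l := by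
  have h1 : ∀ (n r : ℕ), r ≤ 8 → ∑ i ∈ Finset.range (8 * n + r), f (i / 8) =
      ∑ i ∈ Finset.range (8 * n), f (i / 8) + r * f n := by
    intro n r hr
    have h : ∀ x ∈ Finset.range r, f ((8 * n + x) / 8) = f n := by
      intro x hx
      rw [Finset.mem_range] at hx
      rw [Nat.mul_add_div (by norm_num)]
      rw [Nat.div_eq_of_lt (by omega), add_zero]
    rw [Finset.sum_range_add, Finset.sum_congr rfl h]
    simp
  have h2 : ∀ n : ℕ, ∑ i ∈ Finset.range (8 * n), f (i / 8) = 8 * ∑ l ∈ Finset.range n, f l := by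
    intro n
    induction n with
    | zero => simp
    | succ k ih =>
      rw [Nat.mul_succ, h1 k 8 le_rfl, ih, Finset.sum_range_succ]
      push_cast
      ring
  rw [h1 n r hr.le, h2, Finset.sum_range_succ]
  ring

/-- Replacing `μ i` by `μ (i / 8)` absorbs the factor `2` in `2 * t`, at the price of using each
quotient up to eight times. The indices below `8`, where `h8` says nothing, cost `log 2` each. -/
theorem assocWeight_weightSeq_two_mul_le {μ : ℕ → ℝ} (hmono : Monotone μ)
    (hμ : ∀ i : ℕ, 1 ≤ μ i) (hM : IsLC (weightSeq μ)) (h8 : ∀ i, 8 ≤ i → 2 * μ (i / 8) ≤ μ i)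
    {t : ℝ} (ht : 0 < t) :
    assocWeight (weightSeq μ) (2 * t) ≤ 8 * assocWeight (weightSeq μ) t + 8 * Real.log 2 := by
  have hpos : ∀ i, 0 < μ i := fun i => zero_lt_one.trans_le (hμ i)
  have hlog2 : 0 ≤ Real.log 2 := Real.log_nonneg one_le_two
  refine assocWeight_le (by positivity) fun j => ?_
  rw [log_pow_div_weightSeq hμ (by positivity)]
  have hterm : ∀ i, Real.log (2 * t / μ i) ≤
      Real.log (t / μ (i / 8)) + if i < 8 then Real.log 2 else 0 := by
    intro i
    have := hpos i
    have := hpos (i / 8)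
    split_ifs with hi
    · rw [← Real.log_mul (by positivity) (by norm_num)]
      refine Real.log_le_log (by positivity) ?_
      rw [mul_comm, mul_div_right_comm]
      gcongr
      exact hmono (Nat.div_le_self i 8)
    · rw [add_zero]
      refine Real.log_le_log (by positivity) ?_
      rw [div_le_div_iff₀ (by positivity) (by positivity)]
      have := mul_le_mul_of_nonneg_left (h8 i (by omega)) ht.le
      linarith
  have hsum : ∑ i ∈ Finset.range j, (if i < 8 then Real.log 2 else 0) ≤ 8 * Real.log 2 := by
    rw [← Finset.sum_filter, Finset.sum_const, nsmul_eq_mul]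
    refine mul_le_mul_of_nonneg_right ?_ hlog2
    have : (Finset.filter (fun i => i < 8) (Finset.range j)).card ≤ (Finset.range 8).card :=
      Finset.card_le_card fun i hi => by simp at hi ⊢; omega
    rw [Finset.card_range] at this
    exact_mod_cast this
  have hmain : ∑ i ∈ Finset.range j, Real.log (t / μ (i / 8)) ≤
      8 * assocWeight (weightSeq μ) t := by
    have hr : j % 8 < 8 := Nat.mod_lt _ (by norm_num)
    have hr' : ((j % 8 : ℕ) : ℝ) ≤ 8 := by exact_mod_cast hr.le
    have e := sum_range_div_eight (fun l => Real.log (t / μ l)) (j / 8) (j % 8) hr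
    rw [Nat.div_add_mod] at e
    rw [e]
    have h1 := hM.log_le_assocWeight ht (j / 8)
    have h2 := hM.log_le_assocWeight ht (j / 8 + 1)
    rw [log_pow_div_weightSeq hμ ht] at h1 h2
    have h3 := mul_le_mul_of_nonneg_left h1 (sub_nonneg.2 hr')
    have h4 := mul_le_mul_of_nonneg_left h2 (Nat.cast_nonneg (α := ℝ) (j % 8))
    linarith
  have := Finset.sum_le_sum fun i (_ : i ∈ Finset.range j) => hterm i
  rw [Finset.sum_add_distrib] at this
  linarith

theorem isBMTWeight_weightSeq {μ : ℕ → ℝ} (hmono : Monotone μ) (hμ : ∀ i : ℕ, 1 ≤ μ i)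
    (hM : IsLC (weightSeq μ)) (h8 : ∀ i, 8 ≤ i → 2 * μ (i / 8) ≤ μ i) :
    IsBMTWeight (assocWeight (weightSeq μ)) where
  nonneg _ := hM.assocWeight_nonneg
  continuousOn := hM.continuousOn_assocWeight (one_le_weightSeq hμ)
  mono := hM.monotoneOn_assocWeight
  zero := by simp [assocWeight]
  om1 := by
    refine IsBigO.of_bound 9 ?_
    filter_upwards [hM.tendsto_assocWeight.eventually_ge_atTop (8 * Real.log 2),
      eventually_gt_atTop 0] with t h1 ht
    rw [Real.norm_of_nonneg (hM.assocWeight_nonneg (by positivity)),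
      Real.norm_of_nonneg (hM.assocWeight_nonneg ht.le)]
    have := assocWeight_weightSeq_two_mul_le hmono hμ hM h8 ht
    linarith
  om3 := hM.log_isLittleO
  om4 := hM.convexOn_assocWeight

/-! ### Growth of almost subadditive functions under repeated doubling. -/

theorem IsAlmostSubadditive.exists_pow_three_bound {τ : ℝ → ℝ} (h : IsAlmostSubadditive τ) :
    ∃ C : ℝ, 0 ≤ C ∧ ∀ t : ℝ, 0 ≤ t → ∀ m : ℕ, τ (2 ^ m * t) + C ≤ 3 ^ m * (τ t + C) := by
  obtain ⟨C, hC, h⟩ := h (3 / 2) (by norm_num)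
  -- The shift `C / 2` turns `τ (2 s) ≤ 3 τ s + C` into a purely multiplicative recursion.
  refine ⟨C / 2, by linarith, fun t ht m => ?_⟩
  induction m with
  | zero => simp
  | succ m ih =>
    have hs : 0 ≤ 2 ^ m * t := by positivity
    have h1 := h _ _ hs hs
    rw [show (2 : ℝ) ^ (m + 1) * t = 2 ^ m * t + 2 ^ m * t by ring, pow_succ]
    linarith

/-- The threshold on `t` does not depend on `m`, because `2 ^ m * t ≥ t`; later `m` grows together
with `t`. -/
theorem WeightEquiv.exists_pow_three_bound {σ τ : ℝ → ℝ} (hσ : IsWeightFunction σ)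
    (hτ : IsWeightFunction τ) (hστ : WeightEquiv σ τ) (h : IsAlmostSubadditive τ) :
    ∃ A B : ℝ, ∀ᶠ t in atTop, ∀ m : ℕ, σ (2 ^ m * t) ≤ A * 3 ^ m * (σ t + B) := by
  obtain ⟨C, hC, h3⟩ := h.exists_pow_three_bound
  obtain ⟨c₁, hc₁, h1⟩ := hστ.1.exists_pos
  obtain ⟨c₂, hc₂, h2⟩ := hστ.2.exists_pos
  rw [IsBigOWith] at h1 h2
  refine ⟨c₂ * c₁, C / c₁, ?_⟩
  filter_upwards [h1, eventually_forall_ge_atTop.2 h2, eventually_ge_atTop 0] with t ht1 ht2 ht0 m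
  have h2m : t ≤ 2 ^ m * t := le_mul_of_one_le_left ht0 (one_le_pow₀ one_le_two)
  have e2 := ht2 _ h2m
  have hm0 := ht0.trans h2m
  rw [Real.norm_of_nonneg (hσ.nonneg _ hm0), Real.norm_of_nonneg (hτ.nonneg _ hm0)] at e2
  rw [Real.norm_of_nonneg (hσ.nonneg _ ht0), Real.norm_of_nonneg (hτ.nonneg _ ht0)] at ht1
  calc σ (2 ^ m * t) ≤ c₂ * τ (2 ^ m * t) := e2
    _ ≤ c₂ * (3 ^ m * (τ t + C)) := by gcongr; linarith [h3 t ht0 m]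
    _ ≤ c₂ * (3 ^ m * (c₁ * σ t + C)) := by gcongr
    _ = c₂ * c₁ * 3 ^ m * (σ t + C / c₁) := by field_simp

/-! ### Blocks of indices and the block quotients. -/

/-- The endpoints `2 ^ 4 ^ n` of the blocks; each is the fourth power of the preceding one. -/
def blockStart (n : ℕ) : ℕ := 2 ^ 4 ^ n

/-- The index `n` of the block `[blockStart n, blockStart (n + 1))` which contains `i`. -/
def blockIndex (i : ℕ) : ℕ := Nat.log 4 (Nat.log 2 i)

theorem blockStart_succ (n : ℕ) : blockStart (n + 1) = blockStart n ^ 4 := by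
  rw [blockStart, blockStart, pow_succ 4 n, pow_mul]

theorem two_le_blockStart (n : ℕ) : 2 ≤ blockStart n :=
  Nat.le_self_pow (pow_ne_zero _ (by norm_num)) 2

theorem succ_le_blockStart (n : ℕ) : n + 1 ≤ blockStart n :=
  (Nat.succ_le_of_lt (Nat.lt_pow_self (by norm_num : 1 < 4))).trans
    (Nat.lt_pow_self (by norm_num : 1 < 2)).le

theorem blockStart_strictMono : StrictMono blockStart :=
  (pow_right_strictMono₀ (by norm_num : 1 < 2)).comp (pow_right_strictMono₀ (by norm_num : 1 < 4))

theorem tendsto_blockStart : Tendsto (fun n => (blockStart n : ℝ)) atTop atTop :=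
  tendsto_natCast_atTop_atTop.comp blockStart_strictMono.tendsto_atTop

theorem blockIndex_mono : Monotone blockIndex :=
  fun _ _ h => Nat.log_mono_right (Nat.log_mono_right h)

theorem le_blockIndex {n i : ℕ} (h : blockStart n ≤ i) : n ≤ blockIndex i :=
  Nat.le_log_of_pow_le (by norm_num) (Nat.le_log_of_pow_le (by norm_num) h)

theorem blockIndex_le {n i : ℕ} (h : i < blockStart n ^ 4) : blockIndex i ≤ n := by
  rw [← blockStart_succ] at h
  by_contra! hn
  have h1 : 4 ^ (n + 1) ≤ Nat.log 2 i := Nat.pow_le_of_le_log (fun h0 => by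
    rw [blockIndex, h0] at hn; simp at hn) hn
  have h2 : 2 ^ 4 ^ (n + 1) ≤ i := Nat.pow_le_of_le_log (fun h0 => by
    rw [h0] at h1; simp at h1) h1
  exact absurd h (not_lt.2 h2)

theorem lt_blockStart_blockIndex (i : ℕ) : i < blockStart (blockIndex i) ^ 4 := by
  rw [← blockStart_succ]
  by_contra! h
  exact absurd (le_blockIndex h) (by omega)

theorem blockIndex_blockStart (n : ℕ) : blockIndex (blockStart n) = n :=
  le_antisymm (blockIndex_le (lt_self_pow₀ (two_le_blockStart n) (by norm_num)))
    (le_blockIndex le_rfl)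

theorem tendsto_blockIndex : Tendsto blockIndex atTop atTop :=
  tendsto_atTop_atTop.2 fun n => ⟨blockStart n, fun _ h => le_blockIndex h⟩

/-- Quotients which grow like a multiple of the square root on each block. -/
noncomputable def blockQuotient (c : ℕ → ℝ) (i : ℕ) : ℝ := √((i : ℝ) + 1) * c (blockIndex i)

section Block

variable {c : ℕ → ℝ}

theorem blockQuotient_mono (hc : Monotone c) (h1 : ∀ n, 1 ≤ c n) : Monotone (blockQuotient c) := by
  intro i j hij
  have := hc (blockIndex_mono hij)
  have := h1 (blockIndex i)
  unfold blockQuotient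
  gcongr

theorem sqrt_le_blockQuotient (h1 : ∀ n, 1 ≤ c n) (i : ℕ) :
    √((i : ℝ) + 1) ≤ blockQuotient c i :=
  le_mul_of_one_le_right (Real.sqrt_nonneg _) (h1 _)

theorem one_le_blockQuotient (h1 : ∀ n, 1 ≤ c n) (i : ℕ) : 1 ≤ blockQuotient c i :=
  (Real.one_le_sqrt.2 (by linarith [i.cast_nonneg (α := ℝ)])).trans (sqrt_le_blockQuotient h1 i)

theorem two_mul_blockQuotient_div_le (hc : Monotone c) (h1 : ∀ n, 1 ≤ c n) {i : ℕ} (hi : 8 ≤ i) :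
    2 * blockQuotient c (i / 8) ≤ blockQuotient c i := by
  have h2 : 2 * √(((i / 8 : ℕ) : ℝ) + 1) ≤ √((i : ℝ) + 1) := by
    apply Real.le_sqrt_of_sq_le
    rw [mul_pow, Real.sq_sqrt (by positivity)]
    -- Dividing by `8` rather than `4` leaves room for the `+ 1` under the root.
    have : 4 * (i / 8 + 1) ≤ i + 1 := by omega
    have : (4 : ℝ) * (((i / 8 : ℕ) : ℝ) + 1) ≤ i + 1 := by exact_mod_cast this
    linarith
  unfold blockQuotient
  rw [← mul_assoc]
  exact mul_le_mul h2 (hc (blockIndex_mono (Nat.div_le_self i 8)))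
    (zero_le_one.trans (h1 _)) (Real.sqrt_nonneg _)

theorem blockQuotient_le (hc : Monotone c) (h1 : ∀ n, 1 ≤ c n) {n i : ℕ}
    (hi : i < blockStart n ^ 4) : blockQuotient c i ≤ (blockStart n : ℝ) ^ 2 * c n := by
  refine mul_le_mul ?_ (hc (blockIndex_le hi)) (zero_le_one.trans (h1 _)) (by positivity)
  rw [Real.sqrt_le_left (by positivity), ← pow_mul]
  exact_mod_cast hi

theorem le_blockQuotient (hc : Monotone c) (h1 : ∀ n, 1 ≤ c n) {n i : ℕ}
    (hi : blockStart n ^ 2 ≤ i) : blockStart n * c n ≤ blockQuotient c i := by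
  have h2 : blockStart n ≤ i := (Nat.le_self_pow two_ne_zero _).trans hi
  refine mul_le_mul ?_ (hc (le_blockIndex h2)) (zero_le_one.trans (h1 _)) (Real.sqrt_nonneg _)
  apply Real.le_sqrt_of_sq_le
  have : ((blockStart n : ℝ)) ^ 2 ≤ i := by exact_mod_cast hi
  linarith

theorem isLC_block (hc : Monotone c) (h1 : ∀ n, 1 ≤ c n) : IsLC (weightSeq (blockQuotient c)) :=
  isLC_weightSeq (blockQuotient_mono hc h1) (sqrt_le_blockQuotient h1)

/-- Each of the first `a_n ^ 4` quotients is at most `t / 4`, and `4 > e`, so each contributes at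
least `1`. -/
theorem pow_four_le_assocWeight (hc : Monotone c) (h1 : ∀ n, 1 ≤ c n) (n : ℕ) {t : ℝ}
    (ht : 4 * (blockStart n : ℝ) ^ 2 * c n ≤ t) :
    (blockStart n : ℝ) ^ 4 ≤ assocWeight (weightSeq (blockQuotient c)) t := by
  have ha : (0 : ℝ) < blockStart n := by exact_mod_cast zero_lt_two.trans_le (two_le_blockStart n)
  have hcn := zero_lt_one.trans_le (h1 n)
  have ht0 : 0 < t := lt_of_lt_of_le (by positivity) ht
  refine le_trans ?_ ((isLC_block hc h1).log_le_assocWeight ht0 (blockStart n ^ 4))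
  rw [log_pow_div_weightSeq (one_le_blockQuotient h1) ht0]
  have h : ∀ i ∈ Finset.range (blockStart n ^ 4), 1 ≤ Real.log (t / blockQuotient c i) := by
    intro i hi
    have hq := zero_lt_one.trans_le (one_le_blockQuotient h1 i)
    have := blockQuotient_le hc h1 (Finset.mem_range.1 hi)
    rw [Real.le_log_iff_exp_le (by positivity), le_div_iff₀ hq]
    have := Real.exp_one_lt_three
    nlinarith
  have := Finset.card_nsmul_le_sum _ _ _ h
  simpa using this

/-- From index `a_n ^ 2` on the quotients are at least the argument and contribute nothing positive;
each earlier one contributes at most the logarithm of the argument. -/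
theorem assocWeight_le_sq_mul_log (hc : Monotone c) (h1 : ∀ n, 1 ≤ c n) (n : ℕ) :
    assocWeight (weightSeq (blockQuotient c)) (blockStart n * c n) ≤
      (blockStart n : ℝ) ^ 2 * Real.log (blockStart n * c n) := by
  have ha : (1 : ℝ) ≤ blockStart n := by exact_mod_cast one_le_two.trans (two_le_blockStart n)
  set t := blockStart n * c n with ht
  have ht1 : 1 ≤ t := one_le_mul_of_one_le_of_one_le ha (h1 n)
  have ht0 : 0 < t := by linarith
  have hl := Real.log_nonneg ht1
  refine assocWeight_le ht0 fun j => ?_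
  rw [log_pow_div_weightSeq (one_le_blockQuotient h1) ht0]
  have h : ∀ i ∈ Finset.range j, Real.log (t / blockQuotient c i) ≤
      if i < blockStart n ^ 2 then Real.log t else 0 := by
    intro i _
    have hq1 := one_le_blockQuotient h1 i
    have hq := zero_lt_one.trans_le hq1
    split_ifs with hi
    · exact Real.log_le_log (by positivity) (div_le_self ht0.le hq1)
    · exact Real.log_nonpos (by positivity)
        (div_le_one_of_le₀ (le_blockQuotient hc h1 (not_lt.1 hi)) hq.le)
  refine (Finset.sum_le_sum h).trans ?_
  rw [← Finset.sum_filter, Finset.sum_const, nsmul_eq_mul]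
  refine mul_le_mul_of_nonneg_right ?_ hl
  have : (Finset.filter (fun i => i < blockStart n ^ 2) (Finset.range j)).card ≤
      (Finset.range (blockStart n ^ 2)).card :=
    Finset.card_le_card fun i hi => by simp at hi ⊢; omega
  rw [Finset.card_range] at this
  exact_mod_cast this

/-! ### Quasianalyticity and failure of almost subadditivity. -/

theorem isQuasianalytic_block (hc : Monotone c) (h1 : ∀ n, 1 ≤ c n)
    (h2 : ∀ n, c n ≤ (n + 1) * (blockStart n : ℝ) ^ 2) :
    IsQuasianalytic (assocWeight (weightSeq (blockQuotient c))) := by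
  intro hint
  set ω := assocWeight (weightSeq (blockQuotient c))
  set S : ℕ → ℝ := fun n => 4 * (blockStart n : ℝ) ^ 2 * c n with hS
  have ha : ∀ n, (2 : ℝ) ≤ blockStart n := fun n => by exact_mod_cast two_le_blockStart n
  have hS1 : ∀ n, 1 ≤ S n := fun n => by
    have := h1 n
    have := ha n
    have : 1 ≤ (blockStart n : ℝ) ^ 2 := by nlinarith
    simp only [hS]
    nlinarith
  -- This makes the windows `(S n, 2 * S n]` disjoint.
  have hS2 : ∀ n, 2 * S n ≤ S (n + 1) := fun n => by
    have h3 := hc (Nat.le_succ n)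
    have h4 := h1 n
    have h5 : 2 * (blockStart n : ℝ) ^ 2 ≤ (blockStart (n + 1) : ℝ) ^ 2 := by
      rw [blockStart_succ]
      push_cast
      have := ha n
      have h6 : (blockStart n : ℝ) ≤ (blockStart n : ℝ) ^ 4 :=
        le_self_pow₀ (by linarith) (by norm_num)
      have h7 : 4 ≤ (blockStart n : ℝ) ^ 2 := by nlinarith
      have h8 : ((blockStart n : ℝ) ^ 4) ^ 2 =
        (blockStart n : ℝ) ^ 2 * ((blockStart n : ℝ) ^ 2 * (blockStart n : ℝ) ^ 2 *
          (blockStart n : ℝ) ^ 2) := by ring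
      rw [h8]
      nlinarith [mul_le_mul h7 h7 (by norm_num) (by positivity)]
    simp only [hS]
    nlinarith [mul_le_mul h5 h3 (by linarith) (by positivity)]
  have hmono : Monotone S := monotone_nat_of_le_succ fun n => by linarith [hS2 n, hS1 n]
  have hdisj : Pairwise (Function.onFun Disjoint fun n => Set.Ioc (S n) (2 * S n)) :=
    hmono.pairwise_disjoint_on_Ioc_succ.mono fun m n h =>
      h.mono (Set.Ioc_subset_Ioc_right (hS2 m)) (Set.Ioc_subset_Ioc_right (hS2 n))
  have hsub : ⋃ n, Set.Ioc (S n) (2 * S n) ⊆ Set.Ioi 1 :=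
    Set.iUnion_subset fun n t ht => (hS1 n).trans_lt ht.1
  have hsum := (MeasureTheory.hasSum_integral_iUnion (fun n => measurableSet_Ioc) hdisj
    (hint.mono_set hsub)).summable
  have hle : ∀ n : ℕ, 1 / 16 * (1 / ((n + 1 : ℕ) : ℝ)) ≤
      ∫ t in Set.Ioc (S n) (2 * S n), ω t / t ^ 2 := by
    intro n
    have hSn := hS1 n
    have hcn := h1 n
    have han := ha n
    have h3 : ∫ t in Set.Ioc (S n) (2 * S n), (blockStart n : ℝ) ^ 4 / (2 * S n) ^ 2 =
        (blockStart n : ℝ) ^ 4 / (4 * S n) := by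
      rw [MeasureTheory.setIntegral_const, Real.volume_real_Ioc_of_le (by linarith), smul_eq_mul]
      field_simp
      ring
    have h4 : ∫ t in Set.Ioc (S n) (2 * S n), (blockStart n : ℝ) ^ 4 / (2 * S n) ^ 2 ≤
        ∫ t in Set.Ioc (S n) (2 * S n), ω t / t ^ 2 := by
      refine MeasureTheory.setIntegral_mono_on
        (MeasureTheory.integrableOn_const (by simp))
        (hint.mono_set ((Set.subset_iUnion _ n).trans hsub)) measurableSet_Ioc fun t ht => ?_
      have ht0 : 0 < t := by linarith [ht.1]
      have h5 := pow_four_le_assocWeight hc h1 n ht.1.le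
      have h6 := ht.2
      exact div_le_div₀ (le_trans (by positivity) h5) h5 (by positivity) (by gcongr)
    refine le_trans ?_ (h3.symm.trans_le h4)
    rw [div_mul_div_comm, div_le_div_iff₀ (by positivity) (by positivity)]
    simp only [hS]
    push_cast
    have h7 := mul_le_mul_of_nonneg_left (h2 n) (by positivity : 0 ≤ (blockStart n : ℝ) ^ 2)
    nlinarith
  have h := Summable.of_nonneg_of_le (fun n => by positivity) hle hsum
  rw [summable_mul_left_iff (by norm_num),
    summable_nat_add_iff (f := fun n : ℕ => 1 / (n : ℝ)) 1] at h
  exact Real.not_summable_one_div_natCast h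

theorem not_equiv_block (hc : Monotone c) (h1 : ∀ n, 1 ≤ c n)
    (h2 : ∀ n, c n ≤ (n + 1) * (blockStart n : ℝ) ^ 2) :
    ¬ ∃ τ : ℝ → ℝ, IsWeightFunction τ ∧
      WeightEquiv (assocWeight (weightSeq (blockQuotient c))) τ ∧ IsAlmostSubadditive τ := by
  rintro ⟨τ, hτ, hequiv, hsub⟩
  have hM := isLC_block hc h1
  obtain ⟨A, B, hAB⟩ := hequiv.exists_pow_three_bound
    ⟨fun _ => hM.assocWeight_nonneg, hM.monotoneOn_assocWeight, hM.tendsto_assocWeight⟩ hτ hsub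
  have ha : ∀ n, (2 : ℝ) ≤ blockStart n := fun n => by exact_mod_cast two_le_blockStart n
  have htend : Tendsto (fun n => blockStart n * c n) atTop atTop :=
    tendsto_atTop_mono (fun n => le_mul_of_one_le_right (by linarith [ha n]) (h1 n))
      tendsto_blockStart
  have hbound : ∀ᶠ n : ℕ in atTop, (1 : ℝ) ≤
      |A| * 9 * (4 * (((4 ^ n : ℕ) : ℝ) * (3 / 4) ^ 4 ^ n) + |B| * (3 / 4) ^ 4 ^ n) := by
    filter_upwards [htend.eventually hAB] with n hn
    -- This many doublings multiply the argument by `4 * a_n`, joining the two points of the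
    -- estimates.
    have hn := hn (4 ^ n + 2)
    have ha2 : (blockStart n : ℝ) = 2 ^ 4 ^ n := by simp [blockStart]
    have han := ha n
    have hcn := h1 n
    have hlow := pow_four_le_assocWeight hc h1 n
      (t := 2 ^ (4 ^ n + 2) * (blockStart n * c n)) (by rw [pow_add, ← ha2]; linarith)
    have hlog : Real.log (blockStart n * c n) ≤ 4 * ((4 ^ n : ℕ) : ℝ) := by
      have h3 : blockStart n * c n ≤ 2 ^ (4 * 4 ^ n) := by
        have h4 : (n : ℝ) + 1 ≤ blockStart n := by exact_mod_cast succ_le_blockStart n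
        calc blockStart n * c n ≤ blockStart n * (blockStart n * (blockStart n : ℝ) ^ 2) := by
              have := h2 n
              gcongr
              exact this.trans (by gcongr)
          _ = 2 ^ (4 * 4 ^ n) := by rw [ha2, mul_comm 4 (4 ^ n), pow_mul]; ring
      have h5 := Real.log_le_log (by positivity) h3
      rw [Real.log_pow] at h5
      have h6 : Real.log 2 ≤ 1 := by linarith [Real.log_two_lt_d9]
      have h7 := mul_le_mul_of_nonneg_left h6 (Nat.cast_nonneg (α := ℝ) (4 * 4 ^ n))
      push_cast at *
      linarith
    have hup := (assocWeight_le_sq_mul_log hc h1 n).trans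
      (mul_le_mul_of_nonneg_left hlog (by positivity))
    set p : ℕ := 4 ^ n
    set W := assocWeight (weightSeq (blockQuotient c)) (blockStart n * c n)
    have hW : 0 ≤ W := hM.assocWeight_nonneg (by positivity)
    have h9 : (1 : ℝ) ≤ (2 ^ p) ^ 2 := by rw [← ha2]; nlinarith
    have h10 : A * 3 ^ (p + 2) * (W + B) ≤
        |A| * 3 ^ (p + 2) * ((2 ^ p) ^ 2 * (4 * (p : ℝ) + |B|)) := by
      rw [ha2] at hup
      have hb := le_mul_of_one_le_left (abs_nonneg B) h9
      calc A * 3 ^ (p + 2) * (W + B) ≤ |A * 3 ^ (p + 2) * (W + B)| := le_abs_self _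
        _ = |A| * 3 ^ (p + 2) * |W + B| := by
          rw [abs_mul, abs_mul, abs_of_pos (by positivity : (0 : ℝ) < 3 ^ (p + 2))]
        _ ≤ |A| * 3 ^ (p + 2) * (W + |B|) := by
          gcongr
          exact (abs_add_le _ _).trans_eq (by rw [abs_of_nonneg hW])
        _ ≤ _ := by
          gcongr
          linarith
    have h11 := hlow.trans (hn.trans h10)
    have h16 : (blockStart n : ℝ) ^ 4 = 16 ^ p := by
      rw [ha2, ← pow_mul, mul_comm, pow_mul]; norm_num
    -- The decisive gap: `3 * 4 = 12 < 16`, leaving the factor `(3 / 4) ^ p`, which beats the linear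
    -- term in `p`.
    have h12 : (3 : ℝ) ^ (p + 2) * (2 ^ p) ^ 2 = 9 * ((3 / 4) ^ p * 16 ^ p) := by
      rw [← mul_pow, ← pow_mul, mul_comm p 2, pow_mul, pow_add, mul_right_comm, ← mul_pow]
      norm_num
      ring
    rw [h16] at h11
    refine le_of_mul_le_mul_right ?_ (by positivity : (0 : ℝ) < 16 ^ p)
    calc 1 * 16 ^ p ≤ |A| * 3 ^ (p + 2) * ((2 ^ p) ^ 2 * (4 * (p : ℝ) + |B|)) := by
          rwa [one_mul]
      _ = |A| * (3 ^ (p + 2) * (2 ^ p) ^ 2) * (4 * (p : ℝ) + |B|) := by ring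
      _ = _ := by rw [h12]; ring
  have hp : Tendsto (fun n : ℕ => 4 ^ n) atTop atTop :=
    tendsto_pow_atTop_atTop_of_one_lt (by norm_num)
  have t1 := (tendsto_self_mul_const_pow_of_lt_one (r := (3 / 4 : ℝ)) (by norm_num)
    (by norm_num)).comp hp
  have t2 := (tendsto_pow_atTop_nhds_zero_of_lt_one (r := (3 / 4 : ℝ)) (by norm_num)
    (by norm_num)).comp hp
  have t3 := ((t1.const_mul 4).add (t2.const_mul |B|)).const_mul (|A| * 9)
  have := ge_of_tendsto t3 hbound
  norm_num at this

theorem isQuasianalyticExample_block (hc : Monotone c) (h1 : ∀ n, 1 ≤ c n)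
    (h2 : ∀ n, c n ≤ (n + 1) * (blockStart n : ℝ) ^ 2) :
    IsQuasianalyticExample (weightSeq (blockQuotient c)) where
  lc := isLC_block hc h1
  bmt := isBMTWeight_weightSeq (blockQuotient_mono hc h1) (one_le_blockQuotient h1)
    (isLC_block hc h1) fun _ => two_mul_blockQuotient_div_le hc h1
  normalized := (isLC_block hc h1).isNormalizedWeight
    (one_le_weightSeq (one_le_blockQuotient h1))
  quasianalytic := isQuasianalytic_block hc h1 h2
  not_equiv := not_equiv_block hc h1 h2

theorem quotient_block_div (h1 : ∀ n, 1 ≤ c n) (i : ℕ) :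
    quotient (weightSeq (blockQuotient c)) (i + 1) / ((i + 1 : ℕ) : ℝ) =
      c (blockIndex i) / √((i : ℝ) + 1) := by
  have h : √((i : ℝ) + 1) ≠ 0 := (Real.sqrt_pos.2 (by positivity)).ne'
  rw [quotient_weightSeq (one_le_blockQuotient h1), blockQuotient, Nat.cast_succ,
    div_eq_div_iff (by positivity) h]
  nth_rewrite 3 [← Real.mul_self_sqrt (by positivity : (0 : ℝ) ≤ i + 1)]
  ring

end Block

/-! ### The three choices of `c`. -/

theorem exists_example_quotient_div_tendsto_zero : ∃ M : ℕ → ℝ, IsQuasianalyticExample M ∧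
    Tendsto (fun k : ℕ => quotient M k / (k : ℝ)) atTop (𝓝 0) := by
  have h1 : ∀ n : ℕ, (1 : ℝ) ≤ (fun _ : ℕ => (1 : ℝ)) n := fun _ => le_rfl
  refine ⟨_, isQuasianalyticExample_block (c := fun _ => 1) monotone_const h1 fun n => ?_, ?_⟩
  · have ha : (2 : ℝ) ≤ blockStart n := by exact_mod_cast two_le_blockStart n
    exact one_le_mul_of_one_le_of_one_le (by linarith [n.cast_nonneg (α := ℝ)])
      (one_le_pow₀ (by linarith))
  · rw [← tendsto_add_atTop_iff_nat 1]
    simp_rw [quotient_block_div h1]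
    exact tendsto_const_nhds.div_atTop (Real.tendsto_sqrt_atTop.comp
      (tendsto_atTop_add_const_right _ _ tendsto_natCast_atTop_atTop))

theorem exists_example_quotient_div_tendsto_atTop : ∃ M : ℕ → ℝ, IsQuasianalyticExample M ∧
    Tendsto (fun k : ℕ => quotient M k / (k : ℝ)) atTop atTop := by
  have ha : ∀ n, (2 : ℝ) ≤ blockStart n := fun n => by exact_mod_cast two_le_blockStart n
  have h1 : ∀ n : ℕ, (1 : ℝ) ≤ (fun n : ℕ => ((n : ℝ) + 1) * (blockStart n : ℝ) ^ 2) n :=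
    fun n => one_le_mul_of_one_le_of_one_le (by linarith [n.cast_nonneg (α := ℝ)])
      (one_le_pow₀ (by linarith [ha n]))
  refine ⟨_, isQuasianalyticExample_block (c := fun n => (n + 1) * (blockStart n : ℝ) ^ 2)
    (fun m n h => ?_) h1 fun n => le_rfl, ?_⟩
  · have := blockStart_strictMono.monotone h
    dsimp only
    gcongr
  · rw [← tendsto_add_atTop_iff_nat 1]
    simp_rw [quotient_block_div h1]
    -- Within a block `√(i + 1) ≤ a_n ^ 2`, so the ratio is at least `n + 1`.
    refine tendsto_atTop_mono (fun i => ?_)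
      (tendsto_natCast_atTop_atTop.comp tendsto_blockIndex)
    rw [Function.comp_apply, le_div_iff₀ (Real.sqrt_pos.2 (by positivity))]
    have h3 : √((i : ℝ) + 1) ≤ (blockStart (blockIndex i) : ℝ) ^ 2 := by
      rw [Real.sqrt_le_left (by positivity), ← pow_mul]
      exact_mod_cast lt_blockStart_blockIndex i
    gcongr
    linarith

theorem exists_example_quotient_div_oscillating : ∃ M : ℕ → ℝ, IsQuasianalyticExample M ∧
    liminf (fun k : ℕ => ((quotient M k / (k : ℝ) : ℝ) : EReal)) atTop = 0 ∧
    limsup (fun k : ℕ => ((quotient M k / (k : ℝ) : ℝ) : EReal)) atTop = ⊤ := by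
  have ha : ∀ n, (2 : ℝ) ≤ blockStart n := fun n => by exact_mod_cast two_le_blockStart n
  have h1 : ∀ n : ℕ, (1 : ℝ) ≤ (fun n : ℕ => (blockStart n : ℝ)) n := fun n => by
    linarith [ha n]
  refine ⟨_, isQuasianalyticExample_block (c := fun n => (blockStart n : ℝ))
    (fun m n h => ?_) h1 fun n => ?_, ?_, ?_⟩
  · exact Nat.cast_le.2 (blockStart_strictMono.monotone h)
  · have := ha n
    have := n.cast_nonneg (α := ℝ)
    nlinarith [mul_nonneg this (sq_nonneg (blockStart n : ℝ))]
  · refine le_antisymm ?_ (le_liminf_of_le (h := ?_))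
    · have hpos : ∀ n, 0 < blockStart n ^ 4 := fun n =>
        pow_pos (zero_lt_two.trans_le (two_le_blockStart n)) 4
      -- The liminf is tested at the last index `i = a_n ^ 4 - 1` of each block, where the ratio is
      -- exactly `1 / a_n`.
      have hsub : Tendsto (fun n => (blockStart n ^ 4 - 1) + 1) atTop atTop :=
        tendsto_atTop_mono (fun n => (Nat.le_self_pow four_ne_zero _).trans (by omega))
          blockStart_strictMono.tendsto_atTop
      refine (liminf_le_liminf_of_le hsub).trans ?_
      have hlim : Tendsto (fun n => ((1 / (blockStart n : ℝ) : ℝ) : EReal)) atTop (𝓝 0) :=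
        (continuous_coe_real_ereal.tendsto 0).comp
          (tendsto_const_nhds.div_atTop tendsto_blockStart)
      refine (Tendsto.liminf_eq (hlim.congr fun n => ?_)).le
      have hidx : blockIndex (blockStart n ^ 4 - 1) = n :=
        le_antisymm (blockIndex_le (by have := hpos n; omega)) (le_blockIndex (by
          have : blockStart n < blockStart n ^ 4 :=
            lt_self_pow₀ (two_le_blockStart n) (by norm_num)
          omega))
      have hcast : ((blockStart n ^ 4 - 1 : ℕ) : ℝ) + 1 = ((blockStart n : ℝ) ^ 2) ^ 2 := by
        rw [Nat.cast_sub (hpos n)]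
        push_cast
        ring
      have := ha n
      beta_reduce
      rw [quotient_block_div h1, hidx, hcast, Real.sqrt_sq (by positivity)]
      congr 1
      field_simp
    · filter_upwards [eventually_ge_atTop 1] with k hk
      obtain ⟨i, rfl⟩ := Nat.exists_eq_add_of_le' hk
      rw [quotient_block_div h1]
      exact EReal.coe_nonneg.2 (by positivity)
  -- The limsup is tested at the first index of each block, where the ratio is about `√a_n`.
  · have hsub : Tendsto (fun n => blockStart n + 1) atTop atTop :=
      tendsto_atTop_mono (fun n => Nat.le_succ _) blockStart_strictMono.tendsto_atTop
    refine top_le_iff.1 (le_trans ?_ (limsup_le_limsup_of_le hsub))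
    have hlim : Tendsto (fun n => (blockStart n : ℝ) / √((blockStart n : ℝ) + 1)) atTop atTop := by
      refine tendsto_atTop_mono (fun n => ?_)
        (Real.tendsto_sqrt_atTop.comp (tendsto_blockStart.atTop_div_const zero_lt_two))
      have := ha n
      rw [Function.comp_apply, le_div_iff₀ (Real.sqrt_pos.2 (by positivity)),
        ← Real.sqrt_mul (by positivity), Real.sqrt_le_left (by positivity)]
      nlinarith
    refine (Tendsto.limsup_eq ((EReal.tendsto_coe_atTop.comp hlim).congr fun n => ?_)).ge
    simp only [Function.comp_apply]
    rw [quotient_block_div h1, blockIndex_blockStart]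

end UltraWeight

theorem theorem3p8 :
    (∃ M : ℕ → ℝ, UltraWeight.IsQuasianalyticExample M) ∧
    -- case (a)
    (∃ M : ℕ → ℝ, UltraWeight.IsQuasianalyticExample M ∧
      Tendsto (fun k : ℕ => UltraWeight.quotient M k / (k : ℝ)) atTop (𝓝 0)) ∧
    -- case (b)
    (∃ M : ℕ → ℝ, UltraWeight.IsQuasianalyticExample M ∧
      Tendsto (fun k : ℕ => UltraWeight.quotient M k / (k : ℝ)) atTop atTop) ∧
    -- case (c)
    (∃ M : ℕ → ℝ, UltraWeight.IsQuasianalyticExample M ∧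
      liminf (fun k : ℕ => ((UltraWeight.quotient M k / (k : ℝ) : ℝ) : EReal)) atTop = 0 ∧
      limsup (fun k : ℕ => ((UltraWeight.quotient M k / (k : ℝ) : ℝ) : EReal)) atTop = ⊤) := by
  obtain ⟨M, hM, h⟩ := UltraWeight.exists_example_quotient_div_tendsto_zero
  exact ⟨⟨M, hM⟩, ⟨M, hM, h⟩, UltraWeight.exists_example_quotient_div_tendsto_atTop,
    UltraWeight.exists_example_quotient_div_oscillating⟩
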